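/- Let $\langle\cdot,\cdot\rangle$ denote the inner product of $L^2(\mathbb R)$, linear in the first argument, let $T_xf(t)=f(t-x)$ and $M_\omega f(t)=e^{2\pi i\omega t}f(t)$, and let $\varphi(t)=2^{1/4}e^{-\pi t^2}$. Let $\mathcal G=\{\varphi_{n,m}\}_{n,m\in\mathbb Z}$, $\varphi_{n,m}:=T_nM_m\varphi$, be the Gabor system of integer time-frequency shifts of the Gaussian. A family $\Psi=\{\psi_{n,m}\}_{n,m\in\mathbb Z}\subset L^2(\mathbb R)$ is called a reproducing partner for $\mathcal G$ if there is a bounded and boundedly invertible linear operator $S$ on $L^2(\mathbb R)$ that is weakly given by $$\langle Sf,g\rangle=\sum_{n,m\in\mathbb Z}\langle f,\psi_{n,m}\rangle\,\langle\varphi_{n,m},g\rangle .\qquad(*)$$ The double series is understood in at least one of the following two senses: (a) there are finite sets $F_0,F_1,F_2,\ldots\subset\mathbb Z^2$ such that every finite subset of $\mathbb Z^2$ is contained in $F_N$ for all sufficiently large $N$, and such that, for all $f,g\in L^2(\mathbb R)$, the sums over $(n,m)\in F_N$ of the terms in $(*)$ converge to $\langle Sf,g\rangle$ as $N\to\infty$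 (this includes square and rectangular partial sums, every enumeration of $\mathbb Z^2$, and unconditional convergence); or (b) for all $f\in L^2(\mathbb R)$ and all Schwartz functions $g\in\mathcal S(\mathbb R)$ the series in $(*)$ converges absolutely and has the sum $\langle Sf,g\rangle$. Proposition (non-existence of shift-invariant reproducing partners). Let $\Psi$ be a reproducing partner for $\mathcal G$, in the sense (a) or in the sense (b). Then $\Psi$ is not shift-invariant in time, that is, there is no family $\{\psi_m\}_{m\in\mathbb Z}\subset L^2(\mathbb R)$ with $\psi_{n,m}=T_n\psi_m$ for all $n,m\in\mathbb Z$; and $\Psi$ is not shift-invariant in frequency, that is, there is no family $\{\psi_n\}_{n\in\mathbb Z}\subset L^2(\mathbb R)$ with $\psi_{n,m}=M_m\psi_n$ for all $n,m\in\mathbb Z$. -/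

import Mathlib

open MeasureTheory Filter Topology
open scoped SchwartzMap ENNReal

noncomputable section

/-- The Hilbert space `L²(ℝ)` of complex valued functions. -/
abbrev L2R : Type := Lp ℂ 2 (volume : Measure ℝ)

/-- The translation operator `(T_x f)(t) = f (t - x)` on `L²(ℝ)`. -/
def translation (x : ℝ) (f : L2R) : L2R :=
  Lp.compMeasurePreserving (fun t : ℝ => t - x) (measurePreserving_sub_right volume x) f

theorem memLp_modulation (w : ℝ) (f : L2R) :
    MemLp (fun t : ℝ => Complex.exp (2 * Real.pi * Complex.I * w * t) * f t) 2 volume := by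
  refine (Lp.memLp f).congr_norm ?_ ?_
  · exact (Continuous.aestronglyMeasurable (by fun_prop)).mul (Lp.aestronglyMeasurable f)
  · refine Eventually.of_forall fun t => ?_
    have h : (2 * Real.pi * Complex.I * w * t : ℂ) = ((2 * Real.pi * w * t : ℝ) : ℂ) * Complex.I := by
      push_cast
      ring
    rw [norm_mul, h, Complex.norm_exp_ofReal_mul_I, one_mul]

/-- The modulation operator `(M_w f)(t) = exp(2πi w t) f(t)` on `L²(ℝ)`. -/
def modulation (w : ℝ) (f : L2R) : L2R :=
  (memLp_modulation w f).toLp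
    (fun t : ℝ => Complex.exp (2 * Real.pi * Complex.I * w * t) * f t)

theorem memLp_gaussian :
    MemLp (fun t : ℝ => (((2 : ℝ) ^ (1 / 4 : ℝ) * Real.exp (-Real.pi * t ^ 2) : ℝ) : ℂ))
      2 volume := by
  refine (memLp_two_iff_integrable_sq_norm
    (Continuous.aestronglyMeasurable (by fun_prop))).2 ?_
  have h := (integrable_exp_neg_mul_sq (b := 2 * Real.pi) (by positivity)).const_mul
    (((2 : ℝ) ^ (1 / 4 : ℝ)) ^ 2)
  refine h.congr (Eventually.of_forall fun t => ?_)
  simp only [Complex.norm_real, Real.norm_eq_abs, sq_abs, mul_pow]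
  rw [← Real.exp_nat_mul]
  congr 2
  push_cast
  ring

/-- The normalized Gaussian `φ(t) = 2^{1/4} exp(-π t²)` as an element of `L²(ℝ)`. -/
def gaussian : L2R :=
  memLp_gaussian.toLp
    (fun t : ℝ => (((2 : ℝ) ^ (1 / 4 : ℝ) * Real.exp (-Real.pi * t ^ 2) : ℝ) : ℂ))

/-- The Gabor system `𝒢 = {T_n M_m φ}` of integer time-frequency shifts of the Gaussian. -/
def gaussianGabor (k : ℤ × ℤ) : L2R :=
  translation k.1 (modulation k.2 gaussian)

/-- `(Ψ, Φ)` is a reproducing pair for `H`, the series over the index set being summed along the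
finite sets `F 0, F 1, …`: there is a bounded and boundedly invertible operator `S` on `H` with
`⟨S f, g⟩ = ∑ₖ ⟨f, ψₖ⟩ ⟨φₖ, g⟩` for all `f, g`.
(Mathlib's `inner ℂ y x` is `⟨x, y⟩` when `⟨·, ·⟩` is linear in the first argument.) -/
def IsReproducingPair {ι H : Type*} [NormedAddCommGroup H] [InnerProductSpace ℂ H]
    (F : ℕ → Finset ι) (Ψ Φ : ι → H) : Prop :=
  ∃ S : H ≃L[ℂ] H, ∀ f g : H,
    Tendsto (fun N : ℕ => ∑ k ∈ F N, inner ℂ (Ψ k) f * inner ℂ g (Φ k)) atTop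
      (𝓝 (inner ℂ g (S f)))

/-- `(Ψ, Φ)` is a reproducing pair for `L²(ℝ)` in the sense of tempered distributions: there is a
bounded and boundedly invertible operator `S` on `L²(ℝ)` such that, for each `f` in `L²(ℝ)`,
`S f = ∑ₖ ⟨f, ψₖ⟩ φₖ` when tested against Schwartz functions `g`, the series of scalars being
absolutely convergent. -/
def IsTemperedReproducingPair {ι : Type*} (Ψ Φ : ι → L2R) : Prop :=
  ∃ S : L2R ≃L[ℂ] L2R, ∀ (f : L2R) (g : 𝓢(ℝ, ℂ)),
    HasSum (fun k : ι => inner ℂ (Ψ k) f * inner ℂ (g.toLp 2 volume) (Φ k))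
      (inner ℂ (g.toLp 2 volume) (S f))

/-- `Ψ` is shift-invariant in time: `ψ_{n,m} = T_n ψ_m`. -/
def IsTimeShiftInvariant (Ψ : ℤ × ℤ → L2R) : Prop :=
  ∃ η : ℤ → L2R, ∀ n m : ℤ, Ψ (n, m) = translation n (η m)

/-- `Ψ` is shift-invariant in frequency: `ψ_{n,m} = M_m ψ_n`. -/
def IsFrequencyShiftInvariant (Ψ : ℤ × ℤ → L2R) : Prop :=
  ∃ η : ℤ → L2R, ∀ n m : ℤ, Ψ (n, m) = modulation m (η n)

end

open scoped FourierTransform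

noncomputable section

/-! The Gabor system at critical density has a formally biorthogonal window γ = `dualWindow`, namely
`exp (π t²)` times a step function of alternating Gaussian tails. The sums over `k` of `φ(t + k - n)
γ(t + k)` vanish for `n ≠ 0` and do not depend on `t` for `n = 0` (`tsum_gaussian_mul_dualWindow`).
However, γ is not in `L²`: it stays bounded below on an interval of length about `1/k` next to `k +
1/2`, and the harmonic series diverges (`not_memLp_dualWindow`).

Multiplying γ by a smooth 1-periodic cutoff that vanishes near the half-integers gives a Schwartz
function `g`. Periodicity preserves the orthogonality, so by Poisson summation `g` has zero
coefficients against `φ_{n,m}` for `n ≠ 0`, and for `n = 0` they are the Fourier coefficients of a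
function `v` bounded independently of the cutoff. If `ψ_{n,m} = M_m η_n`, the reproducing series
then collapses to `⟨S f, g⟩ = ∫ v f conj(η_0)`, which is at most a constant times `‖η_0‖ ‖f‖`.
Taking `f = S⁻¹ g` bounds `‖g‖` uniformly, and Fatou's lemma, as the cutoffs tend to 1, puts γ in
`L²`, a contradiction.

The Fourier transform fixes the Gaussian and exchanges time shifts with frequency shifts, so the
time-invariant case follows from the other. -/

/-! ### Criteria for Schwartz functions -/

theorem hasTemperateGrowth_deriv {u : ℝ → ℝ} (hu : u.HasTemperateGrowth) :
    (deriv u).HasTemperateGrowth := by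
  refine ⟨(contDiff_infty_iff_deriv.1 hu.1).2, fun n => ?_⟩
  obtain ⟨k, C, h⟩ := hu.2 (n + 1)
  refine ⟨k, C, fun x => ?_⟩
  have := h x
  rw [norm_iteratedFDeriv_eq_norm_iteratedDeriv, iteratedDeriv_succ'] at this
  rwa [norm_iteratedFDeriv_eq_norm_iteratedDeriv]

theorem hasTemperateGrowth_of_periodic {F : Type*} [NormedAddCommGroup F] [NormedSpace ℝ F]
    {u : ℝ → F} (hu : ContDiff ℝ (⊤ : ℕ∞) u) {c : ℝ}
    (hc : c ≠ 0) (hp : Function.Periodic u c) : u.HasTemperateGrowth := by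
  refine ⟨hu, fun n => ?_⟩
  have hper : Function.Periodic (iteratedFDeriv ℝ n u) c := fun x => by
    rw [← iteratedFDeriv_comp_add_right]
    congr 1
    exact funext hp
  obtain ⟨C, hC⟩ := (hper.isBounded_of_continuous hc
    (hu.continuous_iteratedFDeriv (mod_cast le_top))).exists_norm_le
  exact ⟨0, C, fun x => by simpa using hC _ ⟨x, rfl⟩⟩

/-- A class closed under differentiation whose members all decay rapidly contains every iterated
derivative of its members, so no derivative has to be computed explicitly. -/
theorem exists_schwartz_of_hasDerivAt (P : (ℝ → ℂ) → Prop)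
    (hd : ∀ f, P f → ∃ f', P f' ∧ ∀ t, HasDerivAt f (f' t) t)
    (hb : ∀ f, P f → ∀ k : ℕ, ∃ C : ℝ, ∀ t : ℝ, |t| ^ k * ‖f t‖ ≤ C) {f : ℝ → ℂ} (hf : P f) :
    ∃ g : 𝓢(ℝ, ℂ), ⇑g = f := by
  have key : ∀ n : ℕ, ∀ f, P f → ContDiff ℝ n f ∧ P (iteratedDeriv n f) := by
    intro n
    induction n with
    | zero =>
      intro f hf
      obtain ⟨f', -, h⟩ := hd f hf
      refine ⟨?_, by simpa using hf⟩
      exact contDiff_zero.2 (continuous_iff_continuousAt.2 fun t => (h t).continuousAt)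
    | succ n ih =>
      intro f hf
      obtain ⟨f', hf', h⟩ := hd f hf
      have hdf : deriv f = f' := funext fun t => (h t).deriv
      refine ⟨?_, ?_⟩
      · push_cast
        rw [contDiff_succ_iff_deriv]
        refine ⟨fun t => (h t).differentiableAt, by simp, ?_⟩
        rw [hdf]
        exact (ih f' hf').1
      · rw [iteratedDeriv_succ', hdf]
        exact (ih f' hf').2
  refine ⟨⟨f, contDiff_infty.2 fun n => (key n f hf).1, fun k n => ?_⟩, rfl⟩
  obtain ⟨C, hC⟩ := hb _ (key n f hf).2 k
  refine ⟨C, fun x => ?_⟩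
  rw [norm_iteratedFDeriv_eq_norm_iteratedDeriv]
  exact hC x

theorem exists_pow_mul_exp_neg_abs_le (N : ℕ) {ε : ℝ} (hε : 0 < ε) :
    ∃ C : ℝ, ∀ t : ℝ, (1 + |t|) ^ N * Real.exp (-ε * |t|) ≤ C := by
  -- The constant comes from `x ^ N / N! ≤ exp x` at `x = ε (1 + |t|)`.
  refine ⟨N.factorial / ε ^ N * Real.exp ε, fun t => ?_⟩
  have h := Real.pow_div_factorial_le_exp (x := ε * (1 + |t|)) (by positivity) N
  rw [div_le_iff₀ (by positivity), mul_pow] at h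
  have h2 : Real.exp (ε * (1 + |t|)) = Real.exp ε * Real.exp (ε * |t|) := by
    rw [← Real.exp_add]; ring_nf
  rw [h2] at h
  have h3 : Real.exp (-ε * |t|) * Real.exp (ε * |t|) = 1 := by
    rw [← Real.exp_add]; simp
  rw [div_mul_eq_mul_div, le_div_iff₀ (by positivity)]
  calc _ = ε ^ N * (1 + |t|) ^ N * Real.exp (-ε * |t|) := by ring
    _ ≤ Real.exp ε * Real.exp (ε * |t|) * N.factorial * Real.exp (-ε * |t|) := by gcongr
    _ = Real.exp (-ε * |t|) * Real.exp (ε * |t|) * (N.factorial * Real.exp ε) := by ring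
    _ = _ := by rw [h3, one_mul]

/-- A function of temperate growth times a weight which solves `G' = a t G` and decays
exponentially off an open set where the function vanishes is a Schwartz function. -/
theorem exists_schwartz_mul_weight {G : ℝ → ℝ} {a ε C : ℝ} {U : Set ℝ} (hU : IsOpen U)
    (hε : 0 < ε) (hG : ∀ t ∉ U, |G t| ≤ C * Real.exp (-ε * |t|))
    (hG' : ∀ t ∉ U, HasDerivAt G (a * t * G t) t) {u : ℝ → ℝ} (hu : u.HasTemperateGrowth)
    (hu0 : ∀ t ∈ U, u t = 0) :
    ∃ g : 𝓢(ℝ, ℂ), ∀ t, g t = ((u t * G t : ℝ) : ℂ) := by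
  suffices h : ∃ g : 𝓢(ℝ, ℂ), ⇑g = fun t => ((u t * G t : ℝ) : ℂ) from
    h.imp fun g hg t => congrFun hg t
  refine exists_schwartz_of_hasDerivAt
    (fun f => ∃ u : ℝ → ℝ, u.HasTemperateGrowth ∧ (∀ t ∈ U, u t = 0) ∧
      f = fun t => ((u t * G t : ℝ) : ℂ)) ?_ ?_ ⟨u, hu, hu0, rfl⟩
  · rintro f ⟨u, hu, hu0, rfl⟩
    have hz : ∀ t ∈ U, u =ᶠ[𝓝 t] fun _ => 0 := fun t ht => by
      filter_upwards [hU.mem_nhds ht] with y hy using hu0 y hy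
    have hdu : ∀ t ∈ U, deriv u t = 0 := fun t ht => by
      rw [(hz t ht).deriv_eq, deriv_const]
    -- The class is closed under differentiation because `(u G)' = (a t u + u') G`. On `U` both `u`
    -- and `u'` vanish, so the behaviour of `G` there is irrelevant.
    refine ⟨fun t => (((a * t * u t + deriv u t) * G t : ℝ) : ℂ),
      ⟨fun t => a * t * u t + deriv u t, ?_, ?_, rfl⟩, fun t => HasDerivAt.ofReal_comp ?_⟩
    · exact (((Function.HasTemperateGrowth.const a).mul .id').mul hu).add
        (hasTemperateGrowth_deriv hu)
    · intro t ht
      simp [hu0 t ht, hdu t ht]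
    · by_cases ht : t ∈ U
      · rw [hu0 t ht, hdu t ht]
        simp only [mul_zero, add_zero, zero_mul]
        refine (hasDerivAt_const t (0 : ℝ)).congr_of_eventuallyEq ?_
        filter_upwards [hz t ht] with y hy
        simp [hy]
      · have h1 : HasDerivAt u (deriv u t) t :=
          ((hu.1.differentiable (by simp)) t).hasDerivAt
        exact (h1.mul (hG' t ht)).congr_deriv (by ring)
  · rintro f ⟨u, hu, hu0, rfl⟩ k
    obtain ⟨N, D, hD⟩ := hu.2 0
    obtain ⟨B, hB⟩ := exists_pow_mul_exp_neg_abs_le (k + N) hε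
    have hD' : ∀ t, |u t| ≤ |D| * (1 + |t|) ^ N := fun t => by
      have := hD t
      rw [norm_iteratedFDeriv_zero, Real.norm_eq_abs, Real.norm_eq_abs] at this
      exact this.trans (by gcongr; exact le_abs_self D)
    refine ⟨|D| * |C| * B, fun t => ?_⟩
    have hB0 : 0 ≤ B := le_trans (by positivity) (hB 0)
    by_cases ht : t ∈ U
    · simp only [hu0 t ht, zero_mul, Complex.ofReal_zero, norm_zero, mul_zero]
      positivity
    · rw [Complex.norm_real, Real.norm_eq_abs, abs_mul]
      calc |t| ^ k * (|u t| * |G t|)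
          ≤ (1 + |t|) ^ k * ((|D| * (1 + |t|) ^ N) * (|C| * Real.exp (-ε * |t|))) := by
            gcongr
            · linarith [abs_nonneg t]
            · exact hD' t
            · exact (hG t ht).trans (by gcongr; exact le_abs_self C)
        _ = |D| * |C| * ((1 + |t|) ^ (k + N) * Real.exp (-ε * |t|)) := by rw [pow_add]; ring
        _ ≤ _ := by gcongr; exact hB t

theorem exists_schwartz_gaussian :
    ∃ g : 𝓢(ℝ, ℂ), ∀ t : ℝ,
      g t = (((2 : ℝ) ^ (1 / 4 : ℝ) * Real.exp (-Real.pi * t ^ 2) : ℝ) : ℂ) := by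
  refine exists_schwartz_mul_weight (G := fun t => Real.exp (-Real.pi * t ^ 2))
    (a := -2 * Real.pi) (ε := 1) (C := Real.exp 1) isOpen_empty one_pos ?_ ?_
    (Function.HasTemperateGrowth.const _) (by simp)
  · intro t _
    rw [abs_of_pos (Real.exp_pos _), ← Real.exp_add, Real.exp_le_exp, ← sq_abs]
    nlinarith [Real.pi_gt_three, sq_nonneg (|t| - 1), sq_nonneg |t|, abs_nonneg t]
  · intro t _
    have h : HasDerivAt (fun t : ℝ => -Real.pi * t ^ 2) (-Real.pi * (2 * t)) t := by
      simpa using (hasDerivAt_pow 2 t).const_mul (-Real.pi)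
    exact h.exp.congr_deriv (by ring)

/-! ### Time-frequency shifts and the Fourier transform on `L²` -/

theorem coeFn_translation (x : ℝ) (f : L2R) : translation x f =ᵐ[volume] fun t => f (t - x) :=
  Lp.coeFn_compMeasurePreserving f (measurePreserving_sub_right volume x)

theorem coeFn_modulation (w : ℝ) (f : L2R) :
    modulation w f =ᵐ[volume] fun t => Complex.exp (2 * Real.pi * Complex.I * w * t) * f t :=
  MemLp.coeFn_toLp _

theorem norm_exp_two_pi_I_mul_mul (w t : ℝ) :
    ‖Complex.exp (2 * Real.pi * Complex.I * w * t)‖ = 1 := by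
  have h : (2 * Real.pi * Complex.I * w * t : ℂ) = ((2 * Real.pi * w * t : ℝ) : ℂ) * Complex.I := by
    push_cast
    ring
  rw [h, Complex.norm_exp_ofReal_mul_I]

theorem continuous_translation (x : ℝ) : Continuous (translation x) :=
  (Lp.isometry_compMeasurePreserving (measurePreserving_sub_right volume x)).continuous

theorem continuous_modulation (w : ℝ) : Continuous (modulation w) := by
  refine LipschitzWith.continuous (K := 1) (LipschitzWith.of_dist_le_mul fun f g => ?_)
  rw [NNReal.coe_one, one_mul, dist_eq_norm, dist_eq_norm]
  refine Lp.norm_le_norm_of_ae_le ?_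
  filter_upwards [Lp.coeFn_sub (modulation w f) (modulation w g), Lp.coeFn_sub f g,
    coeFn_modulation w f, coeFn_modulation w g] with t h1 h2 h3 h4
  rw [h1, h2, Pi.sub_apply, Pi.sub_apply, h3, h4, ← mul_sub, norm_mul,
    norm_exp_two_pi_I_mul_mul, one_mul]

/-- The commutation phase `exp (-2πi m n)` is 1 at integer points. -/
theorem translation_modulation_int (n m : ℤ) (f : L2R) :
    translation n (modulation m f) = modulation m (translation n f) := by
  refine Lp.ext ?_
  have h := (measurePreserving_sub_right volume (n : ℝ)).quasiMeasurePreserving.ae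
    (coeFn_modulation m f)
  filter_upwards [coeFn_translation n (modulation m f), h, coeFn_modulation m (translation n f),
    coeFn_translation n f] with t h1 h2 h3 h4
  rw [h1, h2, h3, h4]
  congr 1
  rw [Complex.exp_eq_exp_iff_exists_int]
  refine ⟨-(m * n), ?_⟩
  push_cast
  ring

theorem hasTemperateGrowth_exp_int (m : ℤ) :
    (fun t : ℝ => Complex.exp (2 * Real.pi * Complex.I * (m : ℝ) * t)).HasTemperateGrowth := by
  refine hasTemperateGrowth_of_periodic (c := 1) ?_ one_ne_zero fun t => ?_
  · exact Complex.contDiff_exp.comp (contDiff_const.mul Complex.ofRealCLM.contDiff)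
  · rw [Complex.exp_eq_exp_iff_exists_int]
    refine ⟨m, ?_⟩
    push_cast
    ring

theorem translation_toLp (x : ℝ) (g : 𝓢(ℝ, ℂ)) :
    translation x (g.toLp 2) = (g.compSubConstCLM ℂ x).toLp 2 := by
  refine Lp.ext ?_
  have h := (measurePreserving_sub_right volume x).quasiMeasurePreserving.ae
    (g.coeFn_toLp 2 volume)
  filter_upwards [coeFn_translation x (g.toLp 2), h, (g.compSubConstCLM ℂ x).coeFn_toLp 2]
    with t h1 h2 h3
  rw [h1, h2, h3, SchwartzMap.compSubConstCLM_apply]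

theorem modulation_toLp (m : ℤ) (g : 𝓢(ℝ, ℂ)) :
    modulation m (g.toLp 2) = (SchwartzMap.smulLeftCLM ℂ
      (fun t : ℝ => Complex.exp (2 * Real.pi * Complex.I * (m : ℝ) * t)) g).toLp 2 := by
  refine Lp.ext ?_
  filter_upwards [coeFn_modulation m (g.toLp 2), g.coeFn_toLp 2,
    (SchwartzMap.smulLeftCLM ℂ
      (fun t : ℝ => Complex.exp (2 * Real.pi * Complex.I * (m : ℝ) * t)) g).coeFn_toLp 2]
    with t h1 h2 h3
  rw [h1, h2, h3, SchwartzMap.smulLeftCLM_apply_apply (hasTemperateGrowth_exp_int m), smul_eq_mul]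

/-- Density of Schwartz functions reduces the Fourier identities below to changes of variable in
absolutely convergent integrals. -/
theorem eq_of_eq_on_schwartz {A B : L2R → L2R} (hA : Continuous A) (hB : Continuous B)
    (h : ∀ g : 𝓢(ℝ, ℂ), A (g.toLp 2) = B (g.toLp 2)) : A = B :=
  (SchwartzMap.denseRange_toLpCLM (F := ℂ) (p := 2) (μ := (volume : Measure ℝ))
    ENNReal.ofNat_ne_top).equalizer hA hB (funext h)

theorem continuous_fourier_L2R : Continuous fun f : L2R => 𝓕 f :=
  (Lp.fourierTransformₗᵢ ℝ ℂ).continuous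

theorem fourier_translation (n : ℤ) (f : L2R) :
    𝓕 (translation n f) = modulation (-n : ℤ) (𝓕 f) := by
  refine congrFun (eq_of_eq_on_schwartz (A := fun f => 𝓕 (translation n f))
    (continuous_fourier_L2R.comp (continuous_translation n))
    ((continuous_modulation _).comp continuous_fourier_L2R) fun g => ?_) f
  simp only [Function.comp_apply]
  rw [translation_toLp, SchwartzMap.toLp_fourier_eq, SchwartzMap.toLp_fourier_eq, modulation_toLp]
  congr 1
  ext ξ
  rw [SchwartzMap.smulLeftCLM_apply_apply (hasTemperateGrowth_exp_int _), SchwartzMap.fourier_coe,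
    SchwartzMap.fourier_coe, Real.fourier_real_eq_integral_exp_smul,
    Real.fourier_real_eq_integral_exp_smul, ← integral_smul]
  rw [← integral_add_right_eq_self _ (n : ℝ)]
  refine integral_congr_ae (Eventually.of_forall fun t => ?_)
  simp only [SchwartzMap.compSubConstCLM_apply, add_sub_cancel_right, smul_eq_mul]
  rw [← mul_assoc, ← Complex.exp_add]
  congr 2
  push_cast
  ring

theorem fourier_modulation (m : ℤ) (f : L2R) :
    𝓕 (modulation m f) = translation m (𝓕 f) := by
  refine congrFun (eq_of_eq_on_schwartz (A := fun f => 𝓕 (modulation m f))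
    (continuous_fourier_L2R.comp (continuous_modulation m))
    ((continuous_translation _).comp continuous_fourier_L2R) fun g => ?_) f
  simp only [Function.comp_apply]
  rw [modulation_toLp, SchwartzMap.toLp_fourier_eq, SchwartzMap.toLp_fourier_eq, translation_toLp]
  congr 1
  ext ξ
  rw [SchwartzMap.compSubConstCLM_apply, SchwartzMap.fourier_coe,
    SchwartzMap.fourier_coe, Real.fourier_real_eq_integral_exp_smul,
    Real.fourier_real_eq_integral_exp_smul]
  refine integral_congr_ae (Eventually.of_forall fun t => ?_)
  simp only [SchwartzMap.smulLeftCLM_apply_apply (hasTemperateGrowth_exp_int _), smul_eq_mul]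
  rw [← mul_assoc, ← Complex.exp_add]
  congr 2
  push_cast
  ring

theorem fourier_gaussian_L2R : 𝓕 gaussian = gaussian := by
  obtain ⟨g, hg⟩ := exists_schwartz_gaussian
  have h : gaussian = g.toLp 2 := by
    refine Lp.ext ?_
    filter_upwards [g.coeFn_toLp 2, memLp_gaussian.coeFn_toLp] with t h1 h2
    rw [h1, hg]
    exact h2
  rw [h, SchwartzMap.toLp_fourier_eq]
  congr 1
  ext ξ
  have h2 := congrFun (fourier_gaussian_pi (b := 1) (by simp)) ξ
  rw [Real.fourier_real_eq_integral_exp_smul] at h2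
  rw [SchwartzMap.fourier_coe, Real.fourier_real_eq_integral_exp_smul, hg]
  simp_rw [hg, Complex.ofReal_mul, smul_eq_mul, mul_left_comm _ (((2 : ℝ) ^ (1 / 4 : ℝ) : ℝ) : ℂ)]
  rw [integral_const_mul]
  congr 1
  convert h2 using 1
  · refine integral_congr_ae (Eventually.of_forall fun t => ?_)
    simp
  · simp

theorem fourier_gaussianGabor (n m : ℤ) :
    𝓕 (gaussianGabor (n, m)) = gaussianGabor (m, -n) := by
  simp only [gaussianGabor]
  rw [fourier_translation, fourier_modulation, fourier_gaussian_L2R, translation_modulation_int]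

/-! ### Common weak form of the two senses, and its Fourier invariance -/

/-- The reproducing formula tested against Schwartz functions, the finite sums being taken along a
filter that exhausts the index set. -/
def IsWeaklyReproducing (Ψ : ℤ × ℤ → L2R) : Prop :=
  ∃ l : Filter (Finset (ℤ × ℤ)), l.NeBot ∧ l ≤ atTop ∧ ∃ S : L2R ≃L[ℂ] L2R,
    ∀ (f : L2R) (g : 𝓢(ℝ, ℂ)),
      Tendsto (fun s => ∑ k ∈ s, inner ℂ (Ψ k) f * inner ℂ (g.toLp 2 volume) (gaussianGabor k)) l
        (𝓝 (inner ℂ (g.toLp 2 volume) (S f)))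

/-- The rotation `(n, m) ↦ (m, -n)` of the index set, induced by the Fourier transform. -/
def indexRotation : ℤ × ℤ ≃ ℤ × ℤ where
  toFun k := (k.2, -k.1)
  invFun k := (-k.2, k.1)
  left_inv k := by simp
  right_inv k := by simp

theorem IsWeaklyReproducing.fourier {Ψ : ℤ × ℤ → L2R} (h : IsWeaklyReproducing Ψ) :
    IsWeaklyReproducing fun k => 𝓕 (Ψ (indexRotation.symm k)) := by
  obtain ⟨l, hl, hle, S, hS⟩ := h
  let F : L2R ≃L[ℂ] L2R := (Lp.fourierTransformₗᵢ ℝ ℂ).toContinuousLinearEquiv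
  refine ⟨l.map indexRotation.finsetCongr, inferInstance, ?_, (F.symm.trans S).trans F,
    fun f g => ?_⟩
  · refine (map_mono hle).trans ?_
    -- A bijection of the index set carries exhausting finite sets to exhausting finite sets.
    refine tendsto_atTop_atTop.2 fun s => ⟨indexRotation.finsetCongr.symm s, fun t ht => ?_⟩
    intro k hk
    have := @ht (indexRotation.symm k) (by simpa using hk)
    simpa using this
  · rw [tendsto_map'_iff]
    have key := hS (𝓕⁻ f) (𝓕⁻ g)
    convert key using 1
    · ext s
      simp only [Function.comp_apply, Equiv.finsetCongr_apply, Finset.sum_map,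
        Equiv.coe_toEmbedding, Equiv.symm_apply_apply]
      refine Finset.sum_congr rfl fun k _ => ?_
      have h1 : gaussianGabor (indexRotation k) = 𝓕 (gaussianGabor k) :=
        (fourier_gaussianGabor k.1 k.2).symm
      rw [h1, ← SchwartzMap.toLp_fourierInv_eq, ← Lp.inner_fourier_eq (Ψ k),
        ← Lp.inner_fourier_eq _ (gaussianGabor k), FourierTransform.fourier_fourierInv_eq,
        FourierTransform.fourier_fourierInv_eq]
    · congr 1
      rw [← SchwartzMap.toLp_fourierInv_eq, ← Lp.inner_fourier_eq (𝓕⁻ (g.toLp 2 volume)),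
        FourierTransform.fourier_fourierInv_eq]
      rfl

/-! ### Alternating Gaussian tails -/

/-- The Gaussian at the half-integer `j + 1/2`. -/
def gaussHalf (j : ℕ) : ℝ := Real.exp (-Real.pi * (j + 1 / 2) ^ 2)

theorem gaussHalf_succ_le (j : ℕ) : gaussHalf (j + 1) ≤ gaussHalf j / 2 := by
  have h : gaussHalf (j + 1) ≤ Real.exp (-1) * gaussHalf j := by
    rw [gaussHalf, gaussHalf, ← Real.exp_add, Real.exp_le_exp]
    push_cast
    nlinarith [Real.pi_gt_three, (Nat.cast_nonneg j : (0 : ℝ) ≤ j)]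
  have h2 : Real.exp (-1) ≤ 1 / 2 := by linarith [Real.exp_neg_one_lt_d9]
  have h3 : 0 < gaussHalf j := Real.exp_pos _
  nlinarith

theorem summable_gaussHalf : Summable gaussHalf := by
  refine summable_of_ratio_norm_eventually_le (r := 1 / 2) (by norm_num)
    (Eventually.of_forall fun j => ?_)
  have h : ∀ i, ‖gaussHalf i‖ = gaussHalf i := fun i => Real.norm_of_nonneg (Real.exp_pos _).le
  rw [h, h]
  linarith [gaussHalf_succ_le j]

/-- The alternating tails `∑_{l ≥ j} (-1)^(l - j) exp(-π (l + 1/2)²)`. -/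
def altTail (j : ℕ) : ℝ := ∑' l : ℕ, (gaussHalf (j + 2 * l) - gaussHalf (j + 2 * l + 1))

theorem altTail_add_altTail_succ (j : ℕ) : altTail j + altTail (j + 1) = gaussHalf j := by
  have hs : ∀ i : ℕ, Summable fun l : ℕ => gaussHalf (i + 2 * l) := fun i =>
    summable_gaussHalf.comp_injective fun a b h => by simpa using h
  have hd : ∀ i : ℕ, Summable fun l : ℕ => (gaussHalf (i + 2 * l) - gaussHalf (i + 2 * l + 1)) :=
    fun i => (hs i).sub ((hs (i + 1)).congr fun l => by congr 1; ring)
  rw [altTail, altTail, ← (hd j).tsum_add (hd (j + 1))]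
  have h0 := (hs j).tsum_eq_zero_add
  have h1 : Summable fun l : ℕ => gaussHalf (j + 2 * (l + 1)) :=
    (summable_nat_add_iff (f := fun l => gaussHalf (j + 2 * l)) 1).2 (hs j)
  have h2 : ∀ l : ℕ, (gaussHalf (j + 2 * l) - gaussHalf (j + 2 * l + 1)) +
      (gaussHalf (j + 1 + 2 * l) - gaussHalf (j + 1 + 2 * l + 1)) =
      gaussHalf (j + 2 * l) - gaussHalf (j + 2 * (l + 1)) := fun l => by
    rw [show j + 1 + 2 * l = j + 2 * l + 1 by ring, show j + 2 * l + 1 + 1 = j + 2 * (l + 1) by ring]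
    ring
  simp_rw [h2]
  rw [(hs j).tsum_sub h1, h0]
  simp

theorem altTail_nonneg (j : ℕ) : 0 ≤ altTail j :=
  tsum_nonneg fun l => by
    have h := gaussHalf_succ_le (j + 2 * l)
    have : 0 < gaussHalf (j + 2 * l) := Real.exp_pos _
    linarith

theorem altTail_le (j : ℕ) : altTail j ≤ gaussHalf j := by
  linarith [altTail_add_altTail_succ j, altTail_nonneg (j + 1)]

/-- The first term dominates: what is subtracted from it is at most the next term, which is at most
half of it. -/
theorem half_gaussHalf_le_altTail (j : ℕ) : gaussHalf j / 2 ≤ altTail j := by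
  linarith [altTail_add_altTail_succ j, altTail_le (j + 1), gaussHalf_succ_le j]

/-- The two-sided sequence `(-1)^k altTail |k|`. -/
def signedTail (k : ℤ) : ℝ := (-1) ^ k.natAbs * altTail k.natAbs

theorem abs_signedTail (k : ℤ) : |signedTail k| = altTail k.natAbs := by
  rw [signedTail, abs_mul, abs_pow, abs_neg, abs_one, one_pow, one_mul,
    abs_of_nonneg (altTail_nonneg _)]

theorem signedTail_sub_succ (k : ℤ) :
    signedTail k - signedTail (k + 1) =
      (-1 : ℝ) ^ k * Real.exp (-Real.pi * ((k : ℝ) + 1 / 2) ^ 2) := by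
  rcases k with j | j
  · have h1 : (Int.ofNat j + 1).natAbs = j + 1 := by simp; omega
    have := altTail_add_altTail_succ j
    rw [gaussHalf] at this
    rw [signedTail, signedTail, h1]
    simp only [Int.ofNat_eq_natCast, Int.natAbs_natCast, zpow_natCast, Int.cast_natCast]
    rw [← this]
    ring
  · have h1 : (Int.negSucc j).natAbs = j + 1 := rfl
    have h2 : (Int.negSucc j + 1).natAbs = j := by omega
    have := altTail_add_altTail_succ j
    rw [gaussHalf] at this
    have h3 : ((Int.negSucc j : ℤ) : ℝ) = -(j + 1) := by push_cast; ring
    have h4 : (-(j + 1) + 1 / 2 : ℝ) ^ 2 = (j + 1 / 2) ^ 2 := by ring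
    rw [signedTail, signedTail, h1, h2, h3, h4, ← this, zpow_negSucc, ← inv_pow, inv_neg_one]
    ring

/-- Completing the square centres the Gaussian factor at `k = n - 1/2`. The reflection `k ↦ 2n - 1 -
k` preserves it and reverses the sign `(-1)^k`. -/
theorem tsum_alternating_gaussian (n : ℤ) :
    ∑' k : ℤ, Real.exp (2 * Real.pi * n * k) *
      ((-1 : ℝ) ^ k * Real.exp (-Real.pi * ((k : ℝ) + 1 / 2) ^ 2)) = 0 := by
  set F : ℤ → ℝ := fun k => Real.exp (2 * Real.pi * n * k) *
      ((-1 : ℝ) ^ k * Real.exp (-Real.pi * ((k : ℝ) + 1 / 2) ^ 2)) with hF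
  have h : ∀ k, F (2 * n - 1 - k) = -F k := fun k => by
    simp only [hF]
    have hs : (-1 : ℝ) ^ (2 * n - 1 - k) = -(-1 : ℝ) ^ k := by
      rw [show 2 * n - 1 - k = -k + (2 * n + -1) by ring, zpow_add₀ (by norm_num),
        zpow_add₀ (by norm_num), zpow_mul, zpow_neg, ← inv_zpow]
      norm_num
    rw [hs, mul_left_comm, mul_left_comm (Real.exp (2 * Real.pi * n * k)), ← Real.exp_add,
      ← Real.exp_add, neg_mul]
    congr 3
    push_cast
    ring
  have h2 := (Equiv.subLeft (2 * n - 1)).tsum_eq F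
  simp only [Equiv.subLeft_apply, h, tsum_neg] at h2
  linarith

/-- Let `A` be the sum. Shifting the index gives `A = exp (2πn) T`, where `T` has `signedTail (k +
1)` in place of `signedTail k`. The difference `A - T` is the alternating Gaussian sum, which is
zero, so `A = exp (2πn) A` and `A = 0`. -/
theorem tsum_exp_mul_signedTail {n : ℤ} (hn : n ≠ 0) :
    ∑' k : ℤ, Real.exp (2 * Real.pi * n * k) * signedTail k = 0 := by
  by_cases hs : Summable fun k : ℤ => Real.exp (2 * Real.pi * n * k) * signedTail k
  · have h1 := (Equiv.addRight (1 : ℤ)).tsum_eq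
      fun k : ℤ => Real.exp (2 * Real.pi * n * k) * signedTail k
    have hs1 := (Equiv.addRight (1 : ℤ)).summable_iff.2 hs
    simp only [Function.comp_def, Equiv.coe_addRight] at h1 hs1
    have h2 : ∀ k : ℤ, Real.exp (2 * Real.pi * n * (k + 1 : ℤ)) * signedTail (k + 1) =
        Real.exp (2 * Real.pi * n) * (Real.exp (2 * Real.pi * n * k) * signedTail (k + 1)) := by
      intro k
      rw [← mul_assoc, ← Real.exp_add]
      congr 2
      push_cast
      ring
    simp only [h2] at h1 hs1
    have hs2 : Summable fun k : ℤ => Real.exp (2 * Real.pi * n * k) * signedTail (k + 1) :=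
      (summable_mul_left_iff (Real.exp_ne_zero _)).1 hs1
    rw [tsum_mul_left] at h1
    have h3 := hs.tsum_sub hs2
    simp only [← mul_sub, signedTail_sub_succ] at h3
    rw [tsum_alternating_gaussian] at h3
    have h4 : ∑' k : ℤ, Real.exp (2 * Real.pi * n * k) * signedTail (k + 1) =
      ∑' k : ℤ, Real.exp (2 * Real.pi * n * k) * signedTail k := by linarith
    rw [h4] at h1
    by_contra hne
    have h5 : Real.exp (2 * Real.pi * n) = 1 := mul_right_cancel₀ hne (by rw [h1, one_mul])
    rw [Real.exp_eq_one_iff] at h5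
    have h6 : (n : ℝ) ≠ 0 := by exact_mod_cast hn
    exact mul_ne_zero (mul_ne_zero two_ne_zero Real.pi_ne_zero) h6 h5
  -- Without summability, `tsum` takes its default value 0.
  · exact tsum_eq_zero_of_not_summable hs

/-! ### The dual window: biorthogonality, decay, and failure to be in `L²` -/

/-- The window biorthogonal to the integer time-frequency shifts of the Gaussian, up to
normalization. -/
def dualWindow (t : ℝ) : ℝ := Real.exp (Real.pi * t ^ 2) * signedTail ⌊t + 1 / 2⌋

theorem tsum_gaussian_mul_dualWindow (n : ℤ) (t : ℝ) :
    ∑' k : ℤ, Real.exp (-Real.pi * (t + k - n) ^ 2) * dualWindow (t + k) =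
      if n = 0 then ∑' k : ℤ, signedTail k else 0 := by
  -- The squares of `t + k` cancel, leaving an exponent linear in `k`; the rest is a shift of the
  -- index by `⌊t + 1/2⌋`.
  have h1 : ∀ k : ℤ, Real.exp (-Real.pi * (t + k - n) ^ 2) * dualWindow (t + k) =
      Real.exp (-Real.pi * n ^ 2 + 2 * Real.pi * n * (t - ⌊t + 1 / 2⌋)) *
        (Real.exp (2 * Real.pi * n * (⌊t + 1 / 2⌋ + k : ℤ)) * signedTail (⌊t + 1 / 2⌋ + k)) := by
    intro k
    have hf : ⌊t + k + 1 / 2⌋ = ⌊t + 1 / 2⌋ + k := by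
      rw [show t + k + 1 / 2 = t + 1 / 2 + k by ring, Int.floor_add_intCast]
    rw [dualWindow, hf, ← mul_assoc, ← mul_assoc, ← Real.exp_add, ← Real.exp_add]
    congr 2
    push_cast
    ring
  simp_rw [h1]
  have h2 := (Equiv.addLeft ⌊t + 1 / 2⌋).tsum_eq
    fun k : ℤ => Real.exp (2 * Real.pi * n * k) * signedTail k
  simp only [Equiv.coe_addLeft] at h2
  rw [tsum_mul_left, h2]
  split_ifs with hn
  · subst hn
    simp
  · rw [tsum_exp_mul_signedTail hn, mul_zero]

theorem measurable_dualWindow : Measurable dualWindow := by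
  have h : Measurable fun t : ℝ => signedTail ⌊t + 1 / 2⌋ :=
    (measurable_of_countable signedTail).comp (Int.measurable_floor.comp (by fun_prop))
  exact (by fun_prop : Measurable fun t : ℝ => Real.exp (Real.pi * t ^ 2)).mul h

theorem abs_dualWindow (t : ℝ) :
    |dualWindow t| = Real.exp (Real.pi * t ^ 2) * altTail ⌊t + 1 / 2⌋.natAbs := by
  rw [dualWindow, abs_mul, abs_signedTail, abs_of_pos (Real.exp_pos _)]

/-- With `k` the integer nearest to `t` and `s` the distance from `t` to the half-integers, the
exponent is at most `π ((|k| + 1/2 - s)² - (|k| + 1/2)²)`, which decreases linearly in `|k|` at a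
rate proportional to `s`. -/
theorem abs_dualWindow_le {δ t : ℝ} (hδ : 0 < δ) (ht : δ ≤ 1 + Real.cos (2 * Real.pi * t)) :
    |dualWindow t| ≤ Real.exp (Real.pi * δ / 10) * Real.exp (-(Real.pi * δ / 5) * |t|) := by
  set k := ⌊t + 1 / 2⌋ with hk
  have h1 : (k : ℝ) ≤ t + 1 / 2 := Int.floor_le _
  have h2 : t + 1 / 2 < k + 1 := Int.lt_floor_add_one _
  set x := t - k with hx
  have hx1 : |x| ≤ 1 / 2 := abs_le.2 ⟨by linarith, by linarith⟩
  have hcos : Real.cos (2 * Real.pi * t) = -Real.cos (2 * Real.pi * (1 / 2 - |x|)) := by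
    have h : 2 * Real.pi * (1 / 2 - |x|) = Real.pi - |2 * Real.pi * x| := by
      rw [abs_mul, abs_of_pos Real.two_pi_pos]; ring
    rw [h, Real.cos_pi_sub, Real.cos_abs, neg_neg, hx,
      show 2 * Real.pi * (t - k) = 2 * Real.pi * t - k * (2 * Real.pi) by ring,
      Real.cos_sub_int_mul_two_pi]
  set s := 1 / 2 - |x| with hs
  have hs0 : 0 ≤ s := by linarith
  have hs1 : s ≤ 1 / 2 := by linarith [abs_nonneg x]
  -- `δ ≤ 1 - cos (2πs) ≤ 2π² s² ≤ 20 s² ≤ 10 s`, using `s ≤ 1/2`.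
  have hδs : δ / 10 ≤ s := by
    have := Real.one_sub_sq_div_two_le_cos (x := 2 * Real.pi * s)
    have hpi : Real.pi ^ 2 ≤ 10 := by nlinarith [Real.pi_lt_d2, Real.pi_pos]
    nlinarith [mul_nonneg (sq_nonneg s) (sub_nonneg.2 hpi), mul_nonneg hs0 (sub_nonneg.2 hs1)]
  have hkabs : ((k.natAbs : ℕ) : ℝ) = |(k : ℝ)| := by simp
  have htk : |t| ≤ |(k : ℝ)| + 1 / 2 := by
    have := abs_add_le (k : ℝ) x
    rw [show (k : ℝ) + x = t by rw [hx]; ring] at this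
    linarith
  rw [abs_dualWindow]
  refine (mul_le_mul_of_nonneg_left (altTail_le _) (Real.exp_pos _).le).trans ?_
  rw [gaussHalf, hkabs, ← Real.exp_add, ← Real.exp_add, Real.exp_le_exp]
  have ht2 : t ^ 2 ≤ |(k : ℝ)| ^ 2 + 2 * |(k : ℝ)| * |x| + |x| ^ 2 := by
    have := abs_add_le (k : ℝ) x
    rw [show (k : ℝ) + x = t by rw [hx]; ring] at this
    rw [← sq_abs t]
    nlinarith [abs_nonneg t]
  have key : t ^ 2 - (|(k : ℝ)| + 1 / 2) ^ 2 ≤ δ / 10 - δ / 5 * |t| := by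
    have hx2 : |x| = 1 / 2 - s := by rw [hs]; ring
    rw [hx2] at ht2
    nlinarith [abs_nonneg (k : ℝ), mul_le_mul_of_nonneg_right hδs (abs_nonneg (k : ℝ))]
  nlinarith [mul_le_mul_of_nonneg_left key Real.pi_pos.le]

theorem hasDerivAt_dualWindow {t : ℝ} (ht : 0 < 1 + Real.cos (2 * Real.pi * t)) :
    HasDerivAt dualWindow (2 * Real.pi * t * dualWindow t) t := by
  set k := ⌊t + 1 / 2⌋ with hk
  have h1 : (k : ℝ) ≤ t + 1 / 2 := Int.floor_le _
  have h2 : t + 1 / 2 < k + 1 := Int.lt_floor_add_one _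
  have h3 : (k : ℝ) ≠ t + 1 / 2 := fun h => by
    have : 2 * Real.pi * t = k * (2 * Real.pi) - Real.pi := by rw [h]; ring
    rw [this, Real.cos_int_mul_two_pi_sub_pi] at ht
    linarith
  have h4 : dualWindow =ᶠ[𝓝 t] fun y => Real.exp (Real.pi * y ^ 2) * signedTail k := by
    have ho : Set.Ioo ((k : ℝ) - 1 / 2) (k + 1 / 2) ∈ 𝓝 t :=
      Ioo_mem_nhds (by linarith [lt_of_le_of_ne h1 h3]) (by linarith)
    filter_upwards [ho] with y hy
    have : ⌊y + 1 / 2⌋ = k := Int.floor_eq_iff.2 ⟨by linarith [hy.1], by linarith [hy.2]⟩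
    rw [dualWindow, this]
  refine HasDerivAt.congr_of_eventuallyEq ?_ h4
  have h : HasDerivAt (fun t : ℝ => Real.pi * t ^ 2) (Real.pi * (2 * t)) t := by
    simpa using (hasDerivAt_pow 2 t).const_mul Real.pi
  refine (h.exp.mul_const _).congr_deriv ?_
  rw [dualWindow, ← hk]
  ring

theorem sq_dualWindow_ge (k : ℕ) {t : ℝ}
    (ht : t ∈ Set.Ico (k + 1 / 2 - 1 / (2 * (k + 1)) : ℝ) (k + 1 / 2)) :
    Real.exp (-2 * Real.pi) / 4 ≤ dualWindow t ^ 2 := by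
  obtain ⟨h1, h2⟩ := ht
  have hk0 : (0 : ℝ) ≤ k := Nat.cast_nonneg k
  have hle : 1 / (2 * ((k : ℝ) + 1)) ≤ 1 / 2 := by
    rw [div_le_div_iff₀ (by positivity) (by norm_num)]; linarith
  have hfl : ⌊t + 1 / 2⌋ = (k : ℤ) := by
    rw [Int.floor_eq_iff]
    push_cast
    constructor <;> linarith
  rw [← sq_abs, abs_dualWindow, hfl, Int.natAbs_natCast]
  have h3 : Real.exp (-Real.pi) / 2 ≤ Real.exp (Real.pi * t ^ 2) * altTail k := by
    refine le_trans ?_ (mul_le_mul_of_nonneg_left (half_gaussHalf_le_altTail k)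
      (Real.exp_pos _).le)
    rw [gaussHalf, mul_div_assoc', ← Real.exp_add]
    gcongr
    have h4 : (k + 1 / 2 - t) * (2 * ((k : ℝ) + 1)) ≤ 1 := by
      rw [← le_div_iff₀ (by positivity)]; linarith
    -- The interval length is chosen for this: `(k + 1/2 - t)(k + 1/2 + t) ≤ (2k + 1) / (2(k + 1)) ≤
    -- 1`.
    have h5 : -1 ≤ t ^ 2 - (k + 1 / 2) ^ 2 := by nlinarith
    nlinarith [Real.pi_pos]
  have h6 : Real.exp (-2 * Real.pi) = Real.exp (-Real.pi) ^ 2 := by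
    rw [← Real.exp_nat_mul]; congr 1; push_cast; ring
  rw [h6]
  nlinarith [Real.exp_pos (-Real.pi)]

theorem not_memLp_dualWindow : ¬ MemLp dualWindow 2 volume := by
  intro h
  rw [memLp_two_iff_integrable_sq measurable_dualWindow.aestronglyMeasurable] at h
  let J : ℕ → Set ℝ := fun k => Set.Ico (k + 1 / 2 - 1 / (2 * (k + 1)) : ℝ) (k + 1 / 2)
  have hJ : ∀ k : ℕ, ∀ t ∈ J k, ⌊t + 1 / 2⌋ = (k : ℤ) := fun k t ht => by
    have hle : 1 / (2 * ((k : ℝ) + 1)) ≤ 1 / 2 := by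
      rw [div_le_div_iff₀ (by positivity) (by norm_num)]
      linarith [(Nat.cast_nonneg k : (0 : ℝ) ≤ k)]
    rw [Int.floor_eq_iff]
    push_cast
    constructor <;> linarith [ht.1, ht.2]
  have hdisj : Pairwise (Function.onFun Disjoint J) := fun i j hij =>
    Set.disjoint_left.2 fun t hi hj => hij (by exact_mod_cast (hJ i t hi).symm.trans (hJ j t hj))
  have hs := (hasSum_integral_iUnion (fun k => measurableSet_Ico) hdisj
    h.integrableOn).summable
  have hlow : ∀ k : ℕ, Real.exp (-2 * Real.pi) / 8 * (1 / ((k : ℝ) + 1)) ≤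
      ∫ t in J k, dualWindow t ^ 2 := fun k => by
    have h1 : ∫ t in J k, Real.exp (-2 * Real.pi) / 4 ≤ ∫ t in J k, dualWindow t ^ 2 :=
      setIntegral_mono_on (by simp [J]) h.integrableOn measurableSet_Ico
        fun t ht => sq_dualWindow_ge k ht
    refine le_trans (le_of_eq ?_) h1
    have hv : (volume : Measure ℝ).real (J k) = 1 / (2 * ((k : ℝ) + 1)) := by
      rw [Real.volume_real_Ico_of_le (by
        have : 0 ≤ 1 / (2 * ((k : ℝ) + 1)) := by positivity
        linarith)]
      ring
    rw [setIntegral_const, hv, smul_eq_mul]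
    field_simp
    norm_num
  have h2 : Summable fun k : ℕ => Real.exp (-2 * Real.pi) / 8 * (1 / ((k : ℝ) + 1)) :=
    Summable.of_nonneg_of_le (fun k => by positivity) hlow hs
  rw [summable_mul_left_iff (by positivity)] at h2
  refine Real.not_summable_one_div_natCast ((summable_nat_add_iff 1).1 (h2.congr fun k => ?_))
  push_cast
  rfl

/-! ### Truncating the dual window to Schwartz functions -/

/-- A smooth periodic cutoff vanishing near the half-integers. -/
def periodicCutoff (j : ℕ) (t : ℝ) : ℝ :=
  Real.smoothTransition ((j + 1) * (1 + Real.cos (2 * Real.pi * t)) - 1)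

theorem periodicCutoff_add_int (j : ℕ) (t : ℝ) (k : ℤ) :
    periodicCutoff j (t + k) = periodicCutoff j t := by
  rw [periodicCutoff, periodicCutoff,
    show 2 * Real.pi * (t + k) = 2 * Real.pi * t + k * (2 * Real.pi) by ring,
    Real.cos_add_int_mul_two_pi]

theorem hasTemperateGrowth_periodicCutoff (j : ℕ) : (periodicCutoff j).HasTemperateGrowth := by
  refine hasTemperateGrowth_of_periodic (c := 1) ?_ one_ne_zero fun t => ?_
  · exact Real.smoothTransition.contDiff.comp ((contDiff_const.mul (contDiff_const.add
      (Real.contDiff_cos.comp (contDiff_const.mul contDiff_id)))).sub contDiff_const)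
  · exact_mod_cast periodicCutoff_add_int j t 1

theorem tendsto_periodicCutoff {t : ℝ} (ht : 0 < 1 + Real.cos (2 * Real.pi * t)) :
    Tendsto (fun j => periodicCutoff j t) atTop (𝓝 1) := by
  refine tendsto_const_nhds.congr' ?_
  obtain ⟨N, hN⟩ := exists_nat_ge (2 / (1 + Real.cos (2 * Real.pi * t)))
  filter_upwards [eventually_ge_atTop N] with j hj
  refine (Real.smoothTransition.one_of_one_le ?_).symm
  rw [div_le_iff₀ ht] at hN
  have : (N : ℝ) ≤ j := by exact_mod_cast hj
  nlinarith

theorem exists_schwartz_periodicCutoff_mul_dualWindow (j : ℕ) :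
    ∃ g : 𝓢(ℝ, ℂ), ∀ t, g t = ((periodicCutoff j t * dualWindow t : ℝ) : ℂ) := by
  have hδ : (0 : ℝ) < 1 / (j + 1) := by positivity
  refine exists_schwartz_mul_weight (a := 2 * Real.pi)
    (U := {t | 1 + Real.cos (2 * Real.pi * t) < 1 / (j + 1)})
    (isOpen_lt (by fun_prop) continuous_const) (ε := Real.pi * (1 / (j + 1)) / 5) (by positivity)
    (fun t ht => abs_dualWindow_le hδ (not_lt.1 ht))
    (fun t ht => hasDerivAt_dualWindow (hδ.trans_le (not_lt.1 ht)))
    (hasTemperateGrowth_periodicCutoff j) fun t ht => Real.smoothTransition.zero_of_nonpos ?_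
  have h : 1 + Real.cos (2 * Real.pi * t) < 1 / (j + 1) := ht
  rw [lt_div_iff₀ (by positivity)] at h
  linarith

/-! ### Poisson summation and Gabor coefficients -/

theorem summable_norm_restrict_schwartz (f : 𝓢(ℝ, ℂ)) (K : TopologicalSpace.Compacts ℝ) :
    Summable fun n : ℤ => ‖((f : C(ℝ, ℂ)).comp (ContinuousMap.addRight n)).restrict K‖ :=
  summable_of_isBigO (Real.summable_abs_int_rpow one_lt_two)
    ((isBigO_norm_restrict_cocompact (f : C(ℝ, ℂ)) zero_lt_two
      (f.isBigO_cocompact_rpow (-2)) K).comp_tendsto Int.tendsto_coe_cofinite)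

/-- The values of `𝓕 f` at integers are the Fourier coefficients of the periodization of `f`. -/
theorem fourier_int_eq_zero_of_tsum_eq_zero (f : 𝓢(ℝ, ℂ)) (h : ∀ t : ℝ, ∑' k : ℤ, f (t + k) = 0)
    (m : ℤ) : 𝓕 f (m : ℝ) = 0 := by
  have h1 := Real.fourierCoeff_tsum_comp_add (summable_norm_restrict_schwartz f) m
  have h2 : ∀ x : ℝ, (∑' n : ℤ, (f : C(ℝ, ℂ)).comp (ContinuousMap.addRight (n • (1 : ℝ)))) x = 0 := by
    intro x
    rw [← h x]
    simpa using (ContinuousMap.hasSum_apply (ContinuousMap.summable_of_locally_summable_norm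
      (summable_norm_restrict_schwartz f)).hasSum x).tsum_eq.symm
  have h3 : Function.Periodic.lift ((f : C(ℝ, ℂ)).periodic_tsum_comp_add_zsmul 1) =
      fun _ : UnitAddCircle => 0 := by
    funext x
    induction x using QuotientAddGroup.induction_on with
    | H z => exact h2 z
  rw [h3] at h1
  rw [SchwartzMap.fourier_coe]
  refine Eq.trans h1.symm ?_
  simp [fourierCoeff]

theorem summable_fourier_int (f : 𝓢(ℝ, ℂ)) : Summable fun m : ℤ => ‖𝓕 f (m : ℝ)‖ :=
  summable_of_isBigO (Real.summable_abs_int_rpow one_lt_two)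
    ((((𝓕 f).isBigO_cocompact_rpow (-2)).comp_tendsto Int.tendsto_coe_cofinite).norm_left)

theorem hasSum_fourier_int (f : 𝓢(ℝ, ℂ)) (t : ℝ) :
    HasSum (fun m : ℤ => 𝓕 f (m : ℝ) * Complex.exp (2 * Real.pi * Complex.I * (m : ℝ) * t))
      (∑' k : ℤ, f (t + k)) := by
  have hs : Summable fun m : ℤ =>
      𝓕 f (m : ℝ) * Complex.exp (2 * Real.pi * Complex.I * (m : ℝ) * t) := by
    refine Summable.of_norm ((summable_fourier_int f).congr fun m => ?_)
    rw [norm_mul, norm_exp_two_pi_I_mul_mul, mul_one]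
  convert hs.hasSum using 1
  rw [f.tsum_eq_tsum_fourier t]
  refine tsum_congr fun m => ?_
  rw [fourier_coe_apply]
  congr 2
  push_cast
  ring

theorem coeFn_gaussianGabor (n m : ℤ) :
    gaussianGabor (n, m) =ᵐ[volume] fun t : ℝ =>
      Complex.exp (2 * Real.pi * Complex.I * (m : ℝ) * t) *
        (((2 : ℝ) ^ (1 / 4 : ℝ) * Real.exp (-Real.pi * (t - n) ^ 2) : ℝ) : ℂ) := by
  have hq := (measurePreserving_sub_right volume (n : ℝ)).quasiMeasurePreserving
  filter_upwards [coeFn_translation n (modulation m gaussian), hq.ae (coeFn_modulation m gaussian),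
    hq.ae memLp_gaussian.coeFn_toLp] with t h1 h2 h3
  rw [gaussianGabor, h1, h2]
  refine congrArg₂ _ ?_ h3
  rw [Complex.exp_eq_exp_iff_exists_int]
  refine ⟨-(m * n), ?_⟩
  push_cast
  ring

/-- Coefficients against the Gabor system of a test function which is a multiple of the dual
window by a `1`-periodic function. -/
theorem exists_schwartz_inner_gaussianGabor {w : ℝ → ℝ} (hw : ∀ t : ℝ, ∀ k : ℤ, w (t + k) = w t)
    {g : 𝓢(ℝ, ℂ)} (hg : ∀ t, g t = ((w t * dualWindow t : ℝ) : ℂ)) (n : ℤ) :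
    ∃ f : 𝓢(ℝ, ℂ), (∀ m : ℤ, inner ℂ (g.toLp 2 volume) (gaussianGabor (n, m)) =
        𝓕 f ((-m : ℤ) : ℝ)) ∧
      ∀ t : ℝ, ∑' k : ℤ, f (t + k) =
        (((2 : ℝ) ^ (1 / 4 : ℝ) * w t * if n = 0 then ∑' k : ℤ, signedTail k else 0 : ℝ) : ℂ) := by
  obtain ⟨φ, hφ⟩ := exists_schwartz_gaussian
  have hf : ∀ t, SchwartzMap.smulLeftCLM ℂ (φ.compSubConstCLM ℂ (n : ℝ)) g t =
      (((2 : ℝ) ^ (1 / 4 : ℝ) * w t * (Real.exp (-Real.pi * (t - n) ^ 2) * dualWindow t) : ℝ) : ℂ) :=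
    fun t => by
      rw [SchwartzMap.smulLeftCLM_apply_apply (SchwartzMap.hasTemperateGrowth _),
        SchwartzMap.compSubConstCLM_apply, hφ, hg, smul_eq_mul]
      push_cast
      ring
  refine ⟨SchwartzMap.smulLeftCLM ℂ (φ.compSubConstCLM ℂ (n : ℝ)) g, fun m => ?_, fun t => ?_⟩
  · rw [L2.inner_def, SchwartzMap.fourier_coe, Real.fourier_real_eq_integral_exp_smul]
    refine integral_congr_ae ?_
    filter_upwards [g.coeFn_toLp 2 volume, coeFn_gaussianGabor n m] with t h1 h2
    rw [h1, h2, hf, hg, RCLike.inner_apply, Complex.conj_ofReal, smul_eq_mul]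
    have h3 : ((-2 * Real.pi * t * ((-m : ℤ) : ℝ) : ℝ) : ℂ) * Complex.I =
        2 * Real.pi * Complex.I * (m : ℝ) * t := by
      push_cast
      ring
    rw [h3]
    push_cast
    ring
  · simp_rw [hf, hw]
    rw [← Complex.ofReal_tsum, tsum_mul_left, tsum_gaussian_mul_dualWindow]

/-- Absolute summability of the coefficients allows the sum to be taken inside the integral, where
it rebuilds `v`; conjugating the modulation accounts for the index `-m`. -/
theorem hasSum_inner_modulation {a : ℤ → ℂ} (ha : Summable fun m => ‖a m‖) {v : ℝ → ℂ}
    (hv : ∀ t : ℝ, HasSum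
      (fun m : ℤ => a m * Complex.exp (2 * Real.pi * Complex.I * (m : ℝ) * t)) (v t))
    (ψ f : L2R) :
    HasSum (fun m : ℤ => inner ℂ (modulation m ψ) f * a (-m))
      (∫ t, v t * inner ℂ (ψ t) (f t)) := by
  have hint : Integrable (fun t => inner ℂ (ψ t) (f t)) volume := L2.integrable_inner ψ f
  have hm : ∀ m : ℤ, inner ℂ (modulation m ψ) f * a (-m) =
      ∫ t : ℝ, a (-m) * Complex.exp (2 * Real.pi * Complex.I * ((-m : ℤ) : ℝ) * t) *
        inner ℂ (ψ t) (f t) := fun m => by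
    rw [L2.inner_def, mul_comm, ← integral_const_mul]
    refine integral_congr_ae ?_
    filter_upwards [coeFn_modulation m ψ] with t h1
    rw [h1, ← smul_eq_mul (Complex.exp _), inner_smul_left, ← Complex.exp_conj, ← mul_assoc]
    congr 3
    simp [map_ofNat (starRingEnd ℂ) 2]
  simp_rw [hm]
  have hn : ∀ (m : ℤ) (t : ℝ),
      ‖a (-m) * Complex.exp (2 * Real.pi * Complex.I * ((-m : ℤ) : ℝ) * t) * inner ℂ (ψ t) (f t)‖ =
        ‖a (-m)‖ * ‖inner ℂ (ψ t) (f t)‖ := fun m t => by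
    rw [norm_mul, norm_mul, norm_exp_two_pi_I_mul_mul, mul_one]
  have hsum := hasSum_integral_of_summable_integral_norm (μ := (volume : Measure ℝ))
    (F := fun (m : ℤ) (t : ℝ) =>
      a (-m) * Complex.exp (2 * Real.pi * Complex.I * ((-m : ℤ) : ℝ) * t) * inner ℂ (ψ t) (f t))
    (fun m => ?_) ?_
  · have h1 : ∀ t : ℝ, ∑' m : ℤ, a (-m) * Complex.exp (2 * Real.pi * Complex.I * ((-m : ℤ) : ℝ) * t) *
        inner ℂ (ψ t) (f t) = v t * inner ℂ (ψ t) (f t) := fun t =>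
      (((Equiv.neg ℤ).hasSum_iff.2 (hv t)).mul_right _).tsum_eq
    simp_rw [h1] at hsum
    exact hsum
  · refine (hint.norm.const_mul ‖a (-m)‖).mono' ?_ (Eventually.of_forall fun t => (hn m t).le)
    exact (Continuous.aestronglyMeasurable (by fun_prop)).mul hint.aestronglyMeasurable
  · simp_rw [hn, integral_const_mul]
    exact ((Equiv.neg ℤ).summable_iff.2 ha).mul_right _

theorem norm_integral_mul_inner_le {v : ℝ → ℂ} {B : ℝ} (hB : ∀ t, ‖v t‖ ≤ B) (ψ f : L2R) :
    ‖∫ t, v t * inner ℂ (ψ t) (f t)‖ ≤ B * (‖ψ‖ * ‖f‖) := by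
  have hB0 : 0 ≤ B := (norm_nonneg _).trans (hB 0)
  have h1 : ‖∫ t, v t * inner ℂ (ψ t) (f t)‖ ≤ ∫ t, B * (‖ψ t‖ * ‖f t‖) := by
    refine norm_integral_le_of_norm_le ?_ (Eventually.of_forall fun t => ?_)
    · exact ((Lp.memLp ψ).norm.integrable_mul (Lp.memLp f).norm).const_mul B
    · rw [norm_mul]
      exact mul_le_mul (hB t) (norm_inner_le_norm _ _) (norm_nonneg _) hB0
  refine h1.trans ?_
  rw [integral_const_mul]
  refine mul_le_mul_of_nonneg_left ?_ hB0
  -- Cauchy–Schwarz is applied to the moduli, as elements of real `L²`.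
  let ψ' : Lp ℝ 2 (volume : Measure ℝ) := (Lp.memLp ψ).norm.toLp
  let f' : Lp ℝ 2 (volume : Measure ℝ) := (Lp.memLp f).norm.toLp
  have h2 : ∫ t, ‖ψ t‖ * ‖f t‖ = inner ℝ ψ' f' := by
    rw [L2.inner_def]
    refine integral_congr_ae ?_
    filter_upwards [(Lp.memLp ψ).norm.coeFn_toLp, (Lp.memLp f).norm.coeFn_toLp] with t h3 h4
    rw [h3, h4]
    simp [mul_comm]
  have h3 : ‖ψ'‖ = ‖ψ‖ := by rw [Lp.norm_toLp, eLpNorm_norm, Lp.norm_def]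
  have h4 : ‖f'‖ = ‖f‖ := by rw [Lp.norm_toLp, eLpNorm_norm, Lp.norm_def]
  rw [h2, ← h3, ← h4]
  exact real_inner_le_norm _ _

/-! ### The contradiction -/

theorem IsWeaklyReproducing.not_frequencyShiftInvariant {Ψ : ℤ × ℤ → L2R}
    (h : IsWeaklyReproducing Ψ) : ¬ IsFrequencyShiftInvariant Ψ := by
  rintro ⟨η, hη⟩
  obtain ⟨l, hl, hle, S, hS⟩ := h
  set c : ℝ := ∑' k : ℤ, signedTail k
  set B : ℝ := (2 : ℝ) ^ (1 / 4 : ℝ) * |c| with hB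
  -- Only the column `n = 0` enters, and `R` does not depend on the cutoff index `j`.
  set R : ℝ := B * ‖η 0‖ * ‖(S.symm : L2R →L[ℂ] L2R)‖ with hR
  have bound : ∀ j : ℕ, eLpNorm (fun t => periodicCutoff j t * dualWindow t) 2 volume ≤
      ENNReal.ofReal R := by
    intro j
    obtain ⟨g, hg⟩ := exists_schwartz_periodicCutoff_mul_dualWindow j
    choose F hF1 hF2 using exists_schwartz_inner_gaussianGabor (periodicCutoff_add_int j) hg
    have hF0 : ∀ n ≠ 0, ∀ m : ℤ, inner ℂ (g.toLp 2 volume) (gaussianGabor (n, m)) = 0 :=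
      fun n hn m => by
        rw [hF1]
        exact fourier_int_eq_zero_of_tsum_eq_zero _ (fun t => by rw [hF2, if_neg hn]; simp) _
    set v : ℝ → ℂ := fun t => (((2 : ℝ) ^ (1 / 4 : ℝ) * periodicCutoff j t * c : ℝ) : ℂ)
    have hv : ∀ t, ‖v t‖ ≤ B := fun t => by
      have h0 : 0 ≤ periodicCutoff j t := Real.smoothTransition.nonneg _
      have h1 : periodicCutoff j t ≤ 1 := Real.smoothTransition.le_one _
      rw [Complex.norm_real, Real.norm_eq_abs, abs_mul, abs_mul, abs_of_nonneg h0,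
        abs_of_nonneg (by positivity), hB]
      have h2 : (0 : ℝ) ≤ (2 : ℝ) ^ (1 / 4 : ℝ) := by positivity
      exact mul_le_mul_of_nonneg_right (mul_le_of_le_one_right h2 h1) (abs_nonneg c)
    have hsum : ∀ f : L2R, inner ℂ (g.toLp 2 volume) (S f) =
        ∫ t, v t * inner ℂ (η 0 t) (f t) := fun f => by
      have h1 := hasSum_inner_modulation (summable_fourier_int (F 0))
        (v := v) (fun t => by simpa [hF2, v] using hasSum_fourier_int (F 0) t) (η 0) f
      have h2 : HasSum (fun k : ℤ × ℤ => inner ℂ (Ψ k) f *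
          inner ℂ (g.toLp 2 volume) (gaussianGabor k)) (∫ t, v t * inner ℂ (η 0 t) (f t)) := by
        refine ((Prod.mk_right_injective (0 : ℤ)).hasSum_iff ?_).1 ?_
        · rintro ⟨n, m⟩ hnm
          have hn : n ≠ 0 := fun hn => hnm ⟨m, by rw [hn]⟩
          rw [hF0 n hn m, mul_zero]
        · convert h1 using 2 with m
          simp only [Function.comp_apply]
          rw [hF1, hη]
      -- The series converges unconditionally for this `g`, so its limit along `l` is its full sum.
      exact tendsto_nhds_unique (hS f g) (Tendsto.mono_left h2 (by simpa using hle))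
    have hnorm : ‖g.toLp 2 volume‖ ≤ R := by
      -- For `f = S⁻¹ g` the left side is `‖g‖²`, while the right side is at most `R ‖g‖`.
      have h1 := hsum (S.symm (g.toLp 2 volume))
      rw [S.apply_symm_apply, inner_self_eq_norm_sq_to_K] at h1
      have h2 := norm_integral_mul_inner_le hv (η 0) (S.symm (g.toLp 2 volume))
      rw [← h1] at h2
      have h3 : ‖S.symm (g.toLp 2 volume)‖ ≤ ‖(S.symm : L2R →L[ℂ] L2R)‖ * ‖g.toLp 2 volume‖ :=
        (S.symm : L2R →L[ℂ] L2R).le_opNorm _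
      have hB0 : 0 ≤ B := (norm_nonneg _).trans (hv 0)
      have h4 : ‖g.toLp 2 volume‖ ^ 2 ≤ R * ‖g.toLp 2 volume‖ := by
        calc ‖g.toLp 2 volume‖ ^ 2 ≤ B * (‖η 0‖ * ‖S.symm (g.toLp 2 volume)‖) := by simpa using h2
          _ ≤ B * (‖η 0‖ * (‖(S.symm : L2R →L[ℂ] L2R)‖ * ‖g.toLp 2 volume‖)) := by gcongr
          _ = _ := by rw [hR]; ring
      by_contra hlt
      push Not at hlt
      have hR0 : 0 ≤ R := by positivity
      nlinarith
    have hcongr : eLpNorm (fun t => periodicCutoff j t * dualWindow t) 2 volume =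
        eLpNorm g 2 volume :=
      eLpNorm_congr_norm_ae (Eventually.of_forall fun t => by rw [hg, Complex.norm_real])
    rw [SchwartzMap.toLp, Lp.norm_toLp] at hnorm
    rw [hcongr, ENNReal.le_ofReal_iff_toReal_le (g.memLp 2 volume).eLpNorm_ne_top
      (ENNReal.toReal_nonneg.trans hnorm)]
    exact hnorm
  refine not_memLp_dualWindow ⟨measurable_dualWindow.aestronglyMeasurable, ?_⟩
  have hmeas : ∀ j, AEStronglyMeasurable (fun t => periodicCutoff j t * dualWindow t) volume :=
    fun j => (hasTemperateGrowth_periodicCutoff j).1.continuous.aestronglyMeasurable.mul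
      measurable_dualWindow.aestronglyMeasurable
  -- Fatou's lemma; the cutoffs tend to 1 off the half-integers, a countable set.
  refine lt_of_le_of_lt (Lp.eLpNorm_lim_le_liminf_eLpNorm hmeas dualWindow ?_)
    (lt_of_le_of_lt (liminf_le_of_frequently_le' (Eventually.of_forall bound).frequently)
      ENNReal.ofReal_lt_top)
  have hcount : (Set.range fun k : ℤ => (k : ℝ) + 1 / 2).Countable := Set.countable_range _
  filter_upwards [hcount.ae_notMem volume] with t ht
  have hcos : 0 < 1 + Real.cos (2 * Real.pi * t) := by
    refine lt_of_le_of_ne (by linarith [Real.neg_one_le_cos (2 * Real.pi * t)]) fun h0 => ht ?_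
    obtain ⟨k, hk⟩ := Real.cos_eq_neg_one_iff.1
      (show Real.cos (2 * Real.pi * t) = -1 by linarith)
    refine ⟨k, ?_⟩
    have := Real.pi_pos
    have h2 : (2 * Real.pi) * ((k : ℝ) + 1 / 2) = (2 * Real.pi) * t := by rw [← hk]; ring
    exact mul_left_cancel₀ (by positivity) h2
  simpa using (tendsto_periodicCutoff hcos).mul_const (dualWindow t)

theorem IsWeaklyReproducing.not_timeShiftInvariant {Ψ : ℤ × ℤ → L2R}
    (h : IsWeaklyReproducing Ψ) : ¬ IsTimeShiftInvariant Ψ := by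
  rintro ⟨η, hη⟩
  refine h.fourier.not_frequencyShiftInvariant ⟨fun n => 𝓕 (η n), fun n m => ?_⟩
  have h1 : indexRotation.symm (n, m) = (-m, n) := rfl
  simp only [h1]
  rw [hη, fourier_translation, neg_neg]

theorem mainTheorem3 (Ψ : ℤ × ℤ → L2R)
    (hΨ : (∃ F : ℕ → Finset (ℤ × ℤ), Tendsto F atTop atTop ∧ IsReproducingPair F Ψ gaussianGabor) ∨
      IsTemperedReproducingPair Ψ gaussianGabor) :
    ¬ IsTimeShiftInvariant Ψ ∧ ¬ IsFrequencyShiftInvariant Ψ := by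
  have h : IsWeaklyReproducing Ψ := by
    rcases hΨ with ⟨F, hF, S, hS⟩ | ⟨S, hS⟩
    · exact ⟨map F atTop, inferInstance, hF, S, fun f g => tendsto_map'_iff.2 (hS f _)⟩
    · exact ⟨atTop, inferInstance, le_rfl, S, fun f g => by simpa [HasSum] using hS f g⟩
  exact ⟨h.not_timeShiftInvariant, h.not_frequencyShiftInvariant⟩

end
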